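/- **Setting.** A channel $c$ has a fixed finite number of fields, each either of the distinguished type $t$ or not of type $t$; a visible event is $c.v_1\ldots v_k$. Instantiations of $t$ are $T=\{0,\dots,n-1\}$ with $n\ge 1$. A process is a labelled transition system (LTS) over visible events and the internal event $\tau$; its traces are the sequences of visible events it can perform, $P\sqsubseteq_T Q$ means $\mathrm{traces}(Q)\subseteq\mathrm{traces}(P)$, and $f(P)$ is $P$ with every event $e$ renamed to $f(e)$. A function on values of type $t$ is applied to an event by applying it to all fields of type $t$. A specification syntax $Spec(t)$ is a CSP term without free variables other than $t$, built by $$P ::= STOP \mid \alpha\to P \mid P\mathbin{\Box}P \mid P\sqcap P\mid P\rhd P\mid \text{if } b \text{ then } P\text{ else }P\mid X$$ (prefix, external, internal and sliding choice, conditional choice, recursion through process identifiers, which may have parameters), where a construct $\alpha=c\S_1x_1{:}X_1\ldots\S_kx_k{:}X_k$ has in each field a nondeterministic selection $\$x{:}X$, an input $?x{:}X$ or an output $!x$. It is data independent in $t$: selections and inputs of type $t$ range over the whole of $t$, outputs of type $t$ are variables bound earlier, there are no constants or operations of type $t$, and every guard either involves no variable of type $t$ or is built from equality tests on variables of type $t$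 (a "conditional choice on $t$"). Bound variables of type $t$ are taken distinct. (This is the condition **Seq**.) $Spec(T)$ is the process given by the usual operational semantics with $t=T$, where $\$$-selections are resolved by $\tau$-transitions. - $Channels(P)$ is the set of channels of the initial constructs of $P$ (unfolding identifiers, and including both branches of conditionals). $Spec(t)$ satisfies **SeqNorm** if, in addition to **Seq**, for all choices $P\mathbin{\Box}Q$, $P\sqcap Q$, $P\rhd Q$ within $Spec(t)$, $Channels(P)\cap Channels(Q)=\emptyset$ and every conditional choice on $t$ in $P$ and in $Q$ is after a prefix. - $Spec(t)$ satisfies **RevPosConjEqT$_T$** if for every conditional choice on $t$, $\text{if } cond \text{ then } P(x_1,\dots,x_k)\text{ else }Q(x_1,\dots,x_k)$, within $Spec(t)$, $cond$ is a positive conjunction of equality tests, and $Q(v_1,\dots,v_k)\sqsubseteq_T P(v_1,\dots,v_k)$ for all instantiations of $t$ and all values $v_1,\dots,v_k$ of the free variables. - A family of processes $Impl(T)$, one for each $T$, satisfies **TypeSym** if $Impl(T)$ and its renaming by $\pi$ are strongly bisimilar for every $T$ and every bijection $\pi:T\to T$. - A symbolic trace of $Spec(t)$ is a sequence of labels along a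 path from $Spec(t)$ in its semi-symbolic transition system, in which everything not of type $t$ is evaluated as usual while variables of type $t$ are never instantiated. Its labels are $\tau$; conditional events, where a conditional choice on $t$ with guard $cond$ can move to its first branch with label $cond$ and to its second branch with label $\neg cond$, whether or not these are satisfiable, and external and sliding choices are not resolved by such moves; and visible symbolic events $\epsilon$, i.e. constructs in which every field not of type $t$ is the output of a value. Two symbolic traces are non-$t$ equivalent, $\equiv_{non\text{-}t}$, if their restrictions to visible symbolic events have equal length and agree pointwise on the channel and on all fields not of type $t$. Let $!^t(\epsilon)$ be the set of positions of the outputs of type $t$ in $\epsilon$, and $$!^t(\sigma,\epsilon)(Spec(t))=\bigcup\{\,!^t(\epsilon') \mid \sigma'^\frown\langle\epsilon'\rangle \text{ a symbolic trace of } Spec(t),\ \sigma^\frown\langle\epsilon\rangle\equiv_{non\text{-}t}\sigma'^\frown\langle\epsilon'\rangle\,\}.$$ - For $B\in\mathbb N$ and $\#T\ge B+1$, the $B$-collapsing function $\phi:T\to\{0,\dots,B\}$ is $\phi(v)=v$ for $v<B$ and $\phi(v)=B$ for $v\ge B$; so $\phi(T)=\{0,\dots,B\}$. **Theorem (Extendibility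 of traces refinement of systems with replicated components).** Suppose that 1. $Spec(t)$ satisfies **SeqNorm** and **RevPosConjEqT$_T$**; 2. $Impl(t)$ satisfies **TypeSym**; 3. $Thresh_T=\max\{\#\,!^t(\sigma,\epsilon)(Spec(t)) \mid \sigma^\frown\langle\epsilon\rangle \text{ is a symbolic trace of } Spec(t)\}$, read as $0$ if there is no such symbolic trace and as $\infty$ if the sizes are unbounded; 4. $B\ge Thresh_T$; 5. $T$ is an instantiation of $t$ of size at least $B+1$; 6. $\phi$ is the $B$-collapsing function on $T$. If $Spec(\phi(T))\sqsubseteq_T\phi(Impl(T))$, then $Spec(T)\sqsubseteq_T Impl(T)$. -/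

import Mathlib

universe u v

namespace CSP

/-! ## Labelled transition systems, traces, refinement, renaming, bisimulation -/

/-- A labelled transition system over the visible events `Ev`; the label `none` is the internal
event `τ`, the label `some e` is the visible event `e`. -/
structure LTS (Ev : Type) where
  State : Type u
  init : State
  step : State → Option Ev → State → Prop

namespace LTS

/-- `L.Weak s tr s'`: some finite sequence of transitions leads from `s` to `s'`, and its
restriction to visible events is `tr`. -/
inductive Weak {Ev : Type} (L : LTS.{u} Ev) : L.State → List Ev → L.State → Prop
  | refl (s : L.State) : Weak L s [] s
  | tau {s s' s'' : L.State} {tr : List Ev} :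
      L.step s none s' → Weak L s' tr s'' → Weak L s tr s''
  | vis {s s' s'' : L.State} {e : Ev} {tr : List Ev} :
      L.step s (some e) s' → Weak L s' tr s'' → Weak L s (e :: tr) s''

/-- The set of traces of a process. -/
def traces {Ev : Type} (L : LTS.{u} Ev) : Set (List Ev) := {tr | ∃ s, L.Weak L.init tr s}

/-- The renamed process `f(P)`: like `P`, except that every visible event `e` becomes `f e`. -/
def rename {Ev Ev' : Type} (L : LTS.{u} Ev) (f : Ev → Ev') : LTS.{u} Ev' where
  State := L.State
  init := L.init
  step s l s' := ∃ l₀ : Option Ev, L.step s l₀ s' ∧ l = l₀.map f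

/-- Strong bisimilarity of two processes. -/
def Bisimilar {Ev : Type} (L M : LTS.{u} Ev) : Prop :=
  ∃ R : L.State → M.State → Prop, R L.init M.init ∧
    (∀ s t l s', R s t → L.step s l s' → ∃ t', M.step t l t' ∧ R s' t') ∧
    (∀ s t l t', R s t → M.step t l t' → ∃ s', L.step s l s' ∧ R s' t')

/-- Traces refinement `P ⊑_T Q`: every trace of `Q` is a trace of `P`. -/
def TRefinedBy {Ev : Type} (P : LTS.{u} Ev) (Q : LTS.{v} Ev) : Prop := Q.traces ⊆ P.traces

end LTS

/-! ## Signatures and events -/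

/-- The fixed vocabulary: channels, the number of fields of each channel, which of these fields
carry values of the distinguished type `t`, the values that are not of type `t`, and the process
identifiers. An identifier has finitely many parameters of type `t`; a family of identifiers with
further parameters that are not of type `t` is represented by one identifier for each value of
those parameters. -/
structure Sig where
  Chan : Type
  arity : Chan → ℕ
  isT : (c : Chan) → Fin (arity c) → Bool
  Val : Type
  Ident : Type
  params : Ident → ℕ

/-- The fields of channel `c` that are of type `t`. -/
abbrev Sig.TPos (S : Sig) (c : S.Chan) : Type := {i : Fin (S.arity c) // S.isT c i = true}

/-- The fields of channel `c` that are not of type `t`. -/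
abbrev Sig.DPos (S : Sig) (c : S.Chan) : Type := {i : Fin (S.arity c) // S.isT c i = false}

/-- The visible events `c.v₁…vₖ` when `t` is instantiated by `T`. The fields are listed as the
family of those not of type `t` and the family of those of type `t`. -/
structure Event (S : Sig) (T : Type) where
  chan : S.Chan
  data : S.DPos chan → S.Val
  tval : S.TPos chan → T

/-- Application of a function on values of type `t` to an event. -/
def Event.map {S : Sig} {T T' : Type} (f : T → T') (e : Event S T) : Event S T' where
  chan := e.chan
  data := e.data
  tval := fun i => f (e.tval i)

/-! ## Sequential, data independent process syntax

Terms are taken over a type `A` of atoms standing for the values of type `t`. A process syntax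
whose free variables of type `t` are the elements of `A` is a term over `A`; a closed concrete
process is a term over an instantiation `T` of `t`, obtained by substituting values for variables.
A process syntax has no constants of type `t`, so it is a term over variables only.

Variables of type `t` are identified by the field that binds them, so that syntax is taken up to
renaming of bound variables, there are no clashes of names between two branches, and a variable
bound in a construct cannot occur a second time in that construct. Everything that is not of type
`t` is kept as functions of the values of the variables that are not of type `t`. -/

/-- A field not of type `t` of a construct: `$x:X`, `?x:X` or `!e`. The output expression may use
the other fields of the same construct (as in `c?y:Y!y`). -/
inductive DField (S : Sig) (c : S.Chan) : Type
  | nd (X : Set S.Val)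
  | inp (X : Set S.Val)
  | out (e : (S.DPos c → S.Val) → S.Val)

namespace DField

variable {S : Sig} {c : S.Chan}

def IsNd : DField S c → Prop
  | nd _ => True
  | _ => False

/-- The values `d` of the fields respect the field at position `i`: a selected value lies in the
set selected from, an output value is the value of the output expression. -/
def Fits (d : S.DPos c → S.Val) (i : S.DPos c) : DField S c → Prop
  | nd X => d i ∈ X
  | inp X => d i ∈ X
  | out e => d i = e d

/-- A nondeterministic selection is replaced by the output of the value `w`. -/
def resolve (w : S.Val) : DField S c → DField S c
  | nd _ => out fun _ => w
  | inp X => inp X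
  | out e => out e

end DField

/-- A field of type `t` of a construct: `$x:t`, `?x:t` or `!x` with `x` an atom. -/
inductive TField (A : Type) : Type
  | nd
  | inp
  | out (a : A)

namespace TField

variable {A B : Type}

def IsNd : TField A → Prop
  | nd => True
  | _ => False

def IsOut : TField A → Prop
  | out _ => True
  | _ => False

def map (f : A → B) : TField A → TField B
  | nd => nd
  | inp => inp
  | out a => out (f a)

/-- A nondeterministic selection is replaced by the output of `w`. -/
def resolve (w : A) : TField A → TField A
  | nd => out w
  | inp => inp
  | out a => out a

/-- The value `w` is possible in this field. -/
def Fits (w : A) : TField A → Prop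
  | nd => True
  | inp => True
  | out a => w = a

theorem isOut_of_map (f : A → B) {x : TField A} (h : (x.map f).IsOut) : x.IsOut := by
  cases x <;> simp_all [map, IsOut]

end TField

/-- The variables of type `t` bound by a construct on channel `c`: one for each field of type `t`
with the symbol `$` or `?`. -/
abbrev Bound {S : Sig} {c : S.Chan} {A : Type} (ts : S.TPos c → TField A) : Type :=
  {i : S.TPos c // ¬ (ts i).IsOut}

/-- Boolean conditions on `t`: built from equality tests. -/
inductive TCond (A : Type) : Type
  | eq (a b : A)
  | not (g : TCond A)
  | and (g h : TCond A)
  | or (g h : TCond A)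

namespace TCond

variable {A B : Type}

def map (f : A → B) : TCond A → TCond B
  | eq a b => eq (f a) (f b)
  | not g => not (g.map f)
  | and g h => and (g.map f) (h.map f)
  | or g h => or (g.map f) (h.map f)

/-- The truth value of a condition in which values have been substituted for all variables. -/
def Holds : TCond A → Prop
  | eq a b => a = b
  | not g => ¬ g.Holds
  | and g h => g.Holds ∧ h.Holds
  | or g h => g.Holds ∨ h.Holds

/-- The condition is a positive conjunction of equality tests. -/
def IsPosConj : TCond A → Prop
  | eq _ _ => True
  | not _ => False
  | and g h => g.IsPosConj ∧ h.IsPosConj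
  | or _ _ => False

end TCond

/-- Process terms over the atoms `A`:
`STOP`, prefix `c§₁x₁:X₁…§ₖxₖ:Xₖ → P`, external choice, internal choice, sliding choice,
conditional choice on `t`, conditional choice not on `t`, and calls of process identifiers. In a
prefix the continuation depends on the values of the fields not of type `t`, and has the
variables of type `t` bound by the construct as additional atoms. -/
inductive Proc (S : Sig) : Type → Type 1
  | STOP {A : Type} : Proc S A
  | pre {A : Type} (c : S.Chan) (ds : S.DPos c → DField S c) (ts : S.TPos c → TField A)
      (k : (S.DPos c → S.Val) → Proc S (A ⊕ Bound ts)) : Proc S A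
  | ext {A : Type} (P Q : Proc S A) : Proc S A
  | int {A : Type} (P Q : Proc S A) : Proc S A
  | slide {A : Type} (P Q : Proc S A) : Proc S A
  | ifT {A : Type} (g : TCond A) (P Q : Proc S A) : Proc S A
  | ifD {A : Type} (b : Prop) (P Q : Proc S A) : Proc S A
  | call {A : Type} (X : S.Ident) (args : Fin (S.params X) → A) : Proc S A

/-- Simultaneous substitution of the atoms `f a` for the atoms `a`. -/
def Proc.map {S : Sig} : {A B : Type} → (A → B) → Proc S A → Proc S B
  | _, _, _, .STOP => .STOP
  | _, _, f, .pre c ds ts k =>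
      .pre c ds (fun i => (ts i).map f) fun d =>
        (k d).map (Sum.map f fun i => ⟨i.1, fun h => i.2 (TField.isOut_of_map f h)⟩)
  | _, _, f, .ext P Q => .ext (P.map f) (Q.map f)
  | _, _, f, .int P Q => .int (P.map f) (Q.map f)
  | _, _, f, .slide P Q => .slide (P.map f) (Q.map f)
  | _, _, f, .ifT g P Q => .ifT (g.map f) (P.map f) (Q.map f)
  | _, _, f, .ifD b P Q => .ifD b (P.map f) (Q.map f)
  | _, _, f, .call X args => .call X fun i => f (args i)

/-- The global environment, mapping process identifiers to their definitions. The free variables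
of type `t` of a definition are the parameters of the identifier. -/
def Defns (S : Sig) : Type 1 := (X : S.Ident) → Proc S (Fin (S.params X))

/-! ## Standard operational semantics of closed terms -/

section Concrete

variable {S : Sig}

open Classical in
/-- The substitution for the bound variables in the continuation of a prefix when the
nondeterministic selections over `t` are resolved by `v`; the variables of the deterministic
inputs stay bound. -/
noncomputable def resolveVar {T : Type} {c : S.Chan} (ts : S.TPos c → TField T)
    (v : S.TPos c → T) : T ⊕ Bound ts → T ⊕ Bound fun i => (ts i).resolve (v i)
  | .inl a => .inl a
  | .inr i => if h : ((ts i.1).resolve (v i.1)).IsOut then .inl (v i.1) else .inr ⟨i.1, h⟩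

/-- The transition relation on closed terms over an instantiation `T`. -/
inductive Step (E : Defns S) {T : Type} : Proc S T → Option (Event S T) → Proc S T → Prop
  /-- A prefix without nondeterministic selections performs the events that its construct
  describes, and the values of the inputs are substituted for the input variables. -/
  | event {c : S.Chan} {ds : S.DPos c → DField S c} {ts : S.TPos c → TField T}
      {k : (S.DPos c → S.Val) → Proc S (T ⊕ Bound ts)}
      (d : S.DPos c → S.Val) (v : S.TPos c → T) :
      (∀ i, ¬ (ds i).IsNd) → (∀ i, ¬ (ts i).IsNd) →
      (∀ i, (ds i).Fits d i) → (∀ i, (ts i).Fits (v i)) →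
      Step E (.pre c ds ts k) (some ⟨c, d, v⟩) ((k d).map (Sum.elim id fun i => v i.1))
  /-- The nondeterministic selections over types other than `t` are resolved simultaneously, by
  turning them into outputs of the selected values, which are then passed on to the
  continuation. -/
  | selectD {c : S.Chan} {ds : S.DPos c → DField S c} {ts : S.TPos c → TField T}
      {k : (S.DPos c → S.Val) → Proc S (T ⊕ Bound ts)} (d : S.DPos c → S.Val) :
      (∃ i, (ds i).IsNd) → (∀ i, (ds i).IsNd → (ds i).Fits d i) →
      Step E (.pre c ds ts k) none (.pre c (fun i => (ds i).resolve (d i)) ts k)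
  /-- After that, the nondeterministic selections over `t` are resolved simultaneously. -/
  | selectT {c : S.Chan} {ds : S.DPos c → DField S c} {ts : S.TPos c → TField T}
      {k : (S.DPos c → S.Val) → Proc S (T ⊕ Bound ts)} (v : S.TPos c → T) :
      (∀ i, ¬ (ds i).IsNd) → (∃ i, (ts i).IsNd) →
      Step E (.pre c ds ts k) none
        (.pre c ds (fun i => (ts i).resolve (v i)) fun d => (k d).map (resolveVar ts v))
  | extTauL {P P' Q : Proc S T} : Step E P none P' → Step E (.ext P Q) none (.ext P' Q)
  | extTauR {P Q Q' : Proc S T} : Step E Q none Q' → Step E (.ext P Q) none (.ext P Q')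
  | extL {P P' Q : Proc S T} {e : Event S T} :
      Step E P (some e) P' → Step E (.ext P Q) (some e) P'
  | extR {P Q Q' : Proc S T} {e : Event S T} :
      Step E Q (some e) Q' → Step E (.ext P Q) (some e) Q'
  | intL {P Q : Proc S T} : Step E (.int P Q) none P
  | intR {P Q : Proc S T} : Step E (.int P Q) none Q
  | slideTimeout {P Q : Proc S T} : Step E (.slide P Q) none Q
  | slideTau {P P' Q : Proc S T} : Step E P none P' → Step E (.slide P Q) none (.slide P' Q)
  | slideVis {P P' Q : Proc S T} {e : Event S T} :
      Step E P (some e) P' → Step E (.slide P Q) (some e) P'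
  | ifTTrue {g : TCond T} {P Q P' : Proc S T} {l : Option (Event S T)} :
      g.Holds → Step E P l P' → Step E (.ifT g P Q) l P'
  | ifTFalse {g : TCond T} {P Q Q' : Proc S T} {l : Option (Event S T)} :
      ¬ g.Holds → Step E Q l Q' → Step E (.ifT g P Q) l Q'
  | ifDTrue {b : Prop} {P Q P' : Proc S T} {l : Option (Event S T)} :
      b → Step E P l P' → Step E (.ifD b P Q) l P'
  | ifDFalse {b : Prop} {P Q Q' : Proc S T} {l : Option (Event S T)} :
      ¬ b → Step E Q l Q' → Step E (.ifD b P Q) l Q'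
  | call {X : S.Ident} {args : Fin (S.params X) → T} :
      Step E (.call X args) none ((E X).map args)

/-- The concrete process described by a closed term. -/
def Proc.lts (E : Defns S) {T : Type} (P : Proc S T) : LTS.{1} (Event S T) where
  State := Proc S T
  init := P
  step := Step E

/-- The instance `Proc(T)` of a process syntax without free variables other than `t`, for the
instantiation `T = {0, …, n - 1}` of `t`. -/
def Proc.inst (E : Defns S) (P : Proc S Empty) (n : ℕ) : LTS.{1} (Event S (Fin n)) :=
  (P.map (Empty.elim : Empty → Fin n)).lts E

end Concrete

/-! ## Semi-symbolic operational semantics and symbolic traces -/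

/-- A visible symbolic event over the variables `A`: the fields of type `t` are left in symbolic
form, the other fields have been instantiated to outputs of values. -/
structure SymEvent (S : Sig) (A : Type) where
  chan : S.Chan
  data : S.DPos chan → S.Val
  fld : S.TPos chan → TField A

/-- `!^t(ε)`: the positions of the outputs of type `t` (positions are counted from `0`). -/
def SymEvent.outT {S : Sig} {A : Type} (ε : SymEvent S A) : Set ℕ :=
  {m | ∃ i : S.TPos ε.chan, (ε.fld i).IsOut ∧ (i.1 : ℕ) = m}

section Symbolic

variable {S : Sig}

/-- The symbolic transitions that are internal (label `none`) or conditional (label `some cond`,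
where `cond` is the guard of a conditional choice on `t` or the negation of one). -/
inductive SilentStep (E : Defns S) {A : Type} : Proc S A → Option (TCond A) → Proc S A → Prop
  | selectD {c : S.Chan} {ds : S.DPos c → DField S c} {ts : S.TPos c → TField A}
      {k : (S.DPos c → S.Val) → Proc S (A ⊕ Bound ts)} (d : S.DPos c → S.Val) :
      (∃ i, (ds i).IsNd) → (∀ i, (ds i).IsNd → (ds i).Fits d i) →
      SilentStep E (.pre c ds ts k) none (.pre c (fun i => (ds i).resolve (d i)) ts k)
  | extL {P P' Q : Proc S A} {l : Option (TCond A)} :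
      SilentStep E P l P' → SilentStep E (.ext P Q) l (.ext P' Q)
  | extR {P Q Q' : Proc S A} {l : Option (TCond A)} :
      SilentStep E Q l Q' → SilentStep E (.ext P Q) l (.ext P Q')
  | intL {P Q : Proc S A} : SilentStep E (.int P Q) none P
  | intR {P Q : Proc S A} : SilentStep E (.int P Q) none Q
  | slideTimeout {P Q : Proc S A} : SilentStep E (.slide P Q) none Q
  | slide {P P' Q : Proc S A} {l : Option (TCond A)} :
      SilentStep E P l P' → SilentStep E (.slide P Q) l (.slide P' Q)
  | ifTThen {g : TCond A} {P Q : Proc S A} : SilentStep E (.ifT g P Q) (some g) P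
  | ifTElse {g : TCond A} {P Q : Proc S A} : SilentStep E (.ifT g P Q) (some g.not) Q
  | ifDTrue {b : Prop} {P Q P' : Proc S A} {l : Option (TCond A)} :
      b → SilentStep E P l P' → SilentStep E (.ifD b P Q) l P'
  | ifDFalse {b : Prop} {P Q Q' : Proc S A} {l : Option (TCond A)} :
      ¬ b → SilentStep E Q l Q' → SilentStep E (.ifD b P Q) l Q'
  | call {X : S.Ident} {args : Fin (S.params X) → A} :
      SilentStep E (.call X args) none ((E X).map args)

/-- The visible symbolic transitions. The variables bound by the event are additional free
variables of the target. -/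
inductive VisStep (E : Defns S) {A : Type} :
    Proc S A → (ε : SymEvent S A) → Proc S (A ⊕ Bound ε.fld) → Prop
  | event {c : S.Chan} {ds : S.DPos c → DField S c} {ts : S.TPos c → TField A}
      {k : (S.DPos c → S.Val) → Proc S (A ⊕ Bound ts)} (d : S.DPos c → S.Val) :
      (∀ i, ¬ (ds i).IsNd) → (∀ i, (ds i).Fits d i) →
      VisStep E (.pre c ds ts k) ⟨c, d, ts⟩ (k d)
  | extL {P Q : Proc S A} {ε : SymEvent S A} {P' : Proc S (A ⊕ Bound ε.fld)} :
      VisStep E P ε P' → VisStep E (.ext P Q) ε P'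
  | extR {P Q : Proc S A} {ε : SymEvent S A} {Q' : Proc S (A ⊕ Bound ε.fld)} :
      VisStep E Q ε Q' → VisStep E (.ext P Q) ε Q'
  | slide {P Q : Proc S A} {ε : SymEvent S A} {P' : Proc S (A ⊕ Bound ε.fld)} :
      VisStep E P ε P' → VisStep E (.slide P Q) ε P'
  | ifDTrue {b : Prop} {P Q : Proc S A} {ε : SymEvent S A} {P' : Proc S (A ⊕ Bound ε.fld)} :
      b → VisStep E P ε P' → VisStep E (.ifD b P Q) ε P'
  | ifDFalse {b : Prop} {P Q : Proc S A} {ε : SymEvent S A} {Q' : Proc S (A ⊕ Bound ε.fld)} :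
      ¬ b → VisStep E Q ε Q' → VisStep E (.ifD b P Q) ε Q'

/-- Labels of symbolic transitions, together with the type of the variables in scope. -/
inductive SymLabel (S : Sig) : Type 1
  | tau
  | cond {A : Type} (g : TCond A)
  | vis {A : Type} (ε : SymEvent S A)

/-- The label of an internal or conditional symbolic transition. -/
def SymLabel.ofSilent {A : Type} : Option (TCond A) → SymLabel S
  | none => .tau
  | some g => .cond g

/-- `SymTrace E P σ`: the sequence of labels `σ` is a symbolic trace of `P`. -/
inductive SymTrace (E : Defns S) : {A : Type} → Proc S A → List (SymLabel S) → Prop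
  | nil {A : Type} (P : Proc S A) : SymTrace E P []
  | silent {A : Type} {P P' : Proc S A} {l : Option (TCond A)} {σ : List (SymLabel S)} :
      SilentStep E P l P' → SymTrace E P' σ → SymTrace E P (SymLabel.ofSilent l :: σ)
  | vis {A : Type} {P : Proc S A} {ε : SymEvent S A} {P' : Proc S (A ⊕ Bound ε.fld)}
      {σ : List (SymLabel S)} :
      VisStep E P ε P' → SymTrace E P' σ → SymTrace E P (SymLabel.vis ε :: σ)

/-- What a label shows outside type `t`: nothing for internal and conditional labels; the channel
and the fields not of type `t` for visible symbolic events. -/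
def SymLabel.nonT : SymLabel S → Option ((c : S.Chan) × (S.DPos c → S.Val))
  | .tau => none
  | .cond _ => none
  | .vis ε => some ⟨ε.chan, ε.data⟩

/-- Non-`t` equivalence of symbolic traces: their restrictions to visible symbolic events agree
pointwise on the channel and on all fields not of type `t`. -/
def NonTEquiv (σ σ' : List (SymLabel S)) : Prop :=
  σ.filterMap SymLabel.nonT = σ'.filterMap SymLabel.nonT

/-- `!^t(σ, ε)(P)`: all positions of outputs of type `t` in those `ε'` for which some symbolic
trace `σ' ⌢ ⟨ε'⟩` of `P` is non-`t` equivalent to `σ ⌢ ⟨ε⟩`. -/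
def outPositions (E : Defns S) {A : Type} (P : Proc S A) (σ : List (SymLabel S)) {B : Type}
    (ε : SymEvent S B) : Set ℕ :=
  {m | ∃ (σ' : List (SymLabel S)) (B' : Type) (ε' : SymEvent S B'),
    SymTrace E P (σ' ++ [.vis ε']) ∧ NonTEquiv (σ ++ [.vis ε]) (σ' ++ [.vis ε']) ∧
      m ∈ ε'.outT}

/-- `Thresh_T`: the supremum of the sizes `#!^t(σ, ε)(P)` over the symbolic traces `σ ⌢ ⟨ε⟩` of
`P`, in the extended natural numbers. It is the maximum when that exists, `0` when there is no such
trace, and `⊤` when the sizes are unbounded. -/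
noncomputable def thresh (E : Defns S) {A : Type} (P : Proc S A) : ℕ∞ :=
  sSup {N | ∃ (σ : List (SymLabel S)) (B : Type) (ε : SymEvent S B),
    SymTrace E P (σ ++ [.vis ε]) ∧ N = (outPositions E P σ ε).encard}

end Symbolic

/-! ## Conditions on processes -/

section Conditions

variable {S : Sig}

/-- `Within E P Q`: the term `Q` occurs within the process syntax `P`, definitions of the
identifiers that occur included. -/
inductive Within (E : Defns S) {A : Type} (P : Proc S A) : {B : Type} → Proc S B → Prop
  | refl : Within E P P
  | pre {B : Type} {c : S.Chan} {ds : S.DPos c → DField S c} {ts : S.TPos c → TField B}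
      {k : (S.DPos c → S.Val) → Proc S (B ⊕ Bound ts)} (d : S.DPos c → S.Val) :
      Within E P (.pre c ds ts k) → (∀ i, (ds i).Fits d i) → Within E P (k d)
  | extL {B : Type} {Q R : Proc S B} : Within E P (.ext Q R) → Within E P Q
  | extR {B : Type} {Q R : Proc S B} : Within E P (.ext Q R) → Within E P R
  | intL {B : Type} {Q R : Proc S B} : Within E P (.int Q R) → Within E P Q
  | intR {B : Type} {Q R : Proc S B} : Within E P (.int Q R) → Within E P R
  | slideL {B : Type} {Q R : Proc S B} : Within E P (.slide Q R) → Within E P Q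
  | slideR {B : Type} {Q R : Proc S B} : Within E P (.slide Q R) → Within E P R
  | ifTThen {B : Type} {g : TCond B} {Q R : Proc S B} : Within E P (.ifT g Q R) → Within E P Q
  | ifTElse {B : Type} {g : TCond B} {Q R : Proc S B} : Within E P (.ifT g Q R) → Within E P R
  | ifDThen {B : Type} {b : Prop} {Q R : Proc S B} : Within E P (.ifD b Q R) → Within E P Q
  | ifDElse {B : Type} {b : Prop} {Q R : Proc S B} : Within E P (.ifD b Q R) → Within E P R
  | call {B : Type} {X : S.Ident} {args : Fin (S.params X) → B} :
      Within E P (.call X args) → Within E P (E X)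

/-- `HasChannel E P c`: `c` is in `Channels(P)`, the set of the channels of the initial constructs
of `P`. -/
inductive HasChannel (E : Defns S) : {A : Type} → Proc S A → S.Chan → Prop
  | pre {A : Type} {c : S.Chan} {ds : S.DPos c → DField S c} {ts : S.TPos c → TField A}
      {k : (S.DPos c → S.Val) → Proc S (A ⊕ Bound ts)} : HasChannel E (.pre c ds ts k) c
  | extL {A : Type} {P Q : Proc S A} {c : S.Chan} : HasChannel E P c → HasChannel E (.ext P Q) c
  | extR {A : Type} {P Q : Proc S A} {c : S.Chan} : HasChannel E Q c → HasChannel E (.ext P Q) c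
  | intL {A : Type} {P Q : Proc S A} {c : S.Chan} : HasChannel E P c → HasChannel E (.int P Q) c
  | intR {A : Type} {P Q : Proc S A} {c : S.Chan} : HasChannel E Q c → HasChannel E (.int P Q) c
  | slideL {A : Type} {P Q : Proc S A} {c : S.Chan} :
      HasChannel E P c → HasChannel E (.slide P Q) c
  | slideR {A : Type} {P Q : Proc S A} {c : S.Chan} :
      HasChannel E Q c → HasChannel E (.slide P Q) c
  | ifTThen {A : Type} {g : TCond A} {P Q : Proc S A} {c : S.Chan} :
      HasChannel E P c → HasChannel E (.ifT g P Q) c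
  | ifTElse {A : Type} {g : TCond A} {P Q : Proc S A} {c : S.Chan} :
      HasChannel E Q c → HasChannel E (.ifT g P Q) c
  | ifDThen {A : Type} {b : Prop} {P Q : Proc S A} {c : S.Chan} :
      HasChannel E P c → HasChannel E (.ifD b P Q) c
  | ifDElse {A : Type} {b : Prop} {P Q : Proc S A} {c : S.Chan} :
      HasChannel E Q c → HasChannel E (.ifD b P Q) c
  | call {A : Type} {X : S.Ident} {args : Fin (S.params X) → A} {c : S.Chan} :
      HasChannel E (E X) c → HasChannel E (.call X args) c

/-- Some conditional choice on `t` in `P` is not after a prefix. -/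
inductive HasInitialCond (E : Defns S) : {A : Type} → Proc S A → Prop
  | ifT {A : Type} {g : TCond A} {P Q : Proc S A} : HasInitialCond E (.ifT g P Q)
  | extL {A : Type} {P Q : Proc S A} : HasInitialCond E P → HasInitialCond E (.ext P Q)
  | extR {A : Type} {P Q : Proc S A} : HasInitialCond E Q → HasInitialCond E (.ext P Q)
  | intL {A : Type} {P Q : Proc S A} : HasInitialCond E P → HasInitialCond E (.int P Q)
  | intR {A : Type} {P Q : Proc S A} : HasInitialCond E Q → HasInitialCond E (.int P Q)
  | slideL {A : Type} {P Q : Proc S A} : HasInitialCond E P → HasInitialCond E (.slide P Q)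
  | slideR {A : Type} {P Q : Proc S A} : HasInitialCond E Q → HasInitialCond E (.slide P Q)
  | ifDThen {A : Type} {b : Prop} {P Q : Proc S A} :
      HasInitialCond E P → HasInitialCond E (.ifD b P Q)
  | ifDElse {A : Type} {b : Prop} {P Q : Proc S A} :
      HasInitialCond E Q → HasInitialCond E (.ifD b P Q)
  | call {A : Type} {X : S.Ident} {args : Fin (S.params X) → A} :
      HasInitialCond E (E X) → HasInitialCond E (.call X args)

/-- What **SeqNorm** requires of the two arguments of an external, internal or sliding choice. -/
def NormalChoice (E : Defns S) {A : Type} (P Q : Proc S A) : Prop :=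
  (∀ c, ¬ (HasChannel E P c ∧ HasChannel E Q c)) ∧
    ¬ HasInitialCond E P ∧ ¬ HasInitialCond E Q

/-- The condition **SeqNorm**. That the process is sequential and data independent, without
replicated choices, with every guard either on `t` or not on `t`, without name clashes and without
repeated input variables of type `t` (the condition **Seq**), is guaranteed by the syntax of terms
together with the absence of free variables. -/
def SeqNorm (E : Defns S) {A : Type} (P : Proc S A) : Prop :=
  ∀ (B : Type) (Q R : Proc S B),
    (Within E P (.ext Q R) → NormalChoice E Q R) ∧
    (Within E P (.int Q R) → NormalChoice E Q R) ∧
    (Within E P (.slide Q R) → NormalChoice E Q R)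

/-- The condition **RevPosConjEqT** for the traces model: in every conditional choice on `t`, the
guard is a positive conjunction of equality tests, and the positive branch refines the negative
branch for all instantiations `{0, …, n - 1}` of `t` and all values of the variables. -/
def RevPosConjEqT (E : Defns S) {A : Type} (P : Proc S A) : Prop :=
  ∀ (B : Type) (g : TCond B) (Q R : Proc S B), Within E P (.ifT g Q R) →
    g.IsPosConj ∧ ∀ n : ℕ, 0 < n → ∀ Γ : B → Fin n,
      LTS.TRefinedBy ((R.map Γ).lts E) ((Q.map Γ).lts E)

/-- The condition **TypeSym** for a family of processes, one for each instantiation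
`{0, …, n - 1}` of `t`: every instance is bisimilar to its renaming by any bijection of the
instantiation. -/
def TypeSym (Proc : (n : ℕ) → LTS.{u} (Event S (Fin n))) : Prop :=
  ∀ n : ℕ, 0 < n → ∀ π : Fin n ≃ Fin n,
    LTS.Bisimilar (Proc n) ((Proc n).rename (Event.map π))

/-- `φ : {0, …, n - 1} → {0, …, B}` is a `B`-collapsing function. -/
def IsCollapsing (B : ℕ) {n : ℕ} (φ : Fin n → Fin (B + 1)) : Prop :=
  ∀ v : Fin n, ((v : ℕ) < B → (φ v : ℕ) = v) ∧ (B ≤ (v : ℕ) → (φ v : ℕ) = B)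

end Conditions

end CSP

/-! Traces of the implementation are treated by induction on length, one last event `e` at a time.
Let `tr ⌢ ⟨e⟩` be a trace of `Impl(T)`, with `tr` already a trace of `Spec(T)`. The channels and
non-`t` data of `tr ⌢ ⟨e⟩` determine a set `D` of at most `B` positions at which the specification
can output in its last event (`exists_outputsIn`). So `e` carries at most `B` values at these
positions, and some permutation `π` of `T` moves them below `B` (`exists_perm_lt`). With `f = φ ∘
π`, no other value has the same image as one of them. Type symmetry and the assumed refinement make
`f(tr ⌢ ⟨e⟩)` a trace of `Spec(φ(T))`.

It remains to lift back the last event (`accepts_concat_of_map`). The run for `tr` and the run for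
its image are followed together. Disjoint channels force them to the same side of each choice. A
true guard stays true under `f`; where a false guard becomes true, reverse refinement moves the
image run to the negative branch. Hence `f` may identify values of `tr` freely. Once `tr` is used
up, only the image run is left to follow (`accepts_singleton_of_map`): each output of `e` lies in
`D`, where equality after `f` gives equality before it.

Both arguments work with terms under valuations, which keep the symbolic term and its instances
together; `mem_traces_map_iff` links this to the operational semantics. -/

namespace CSP

variable {S : Sig}

/-! ## Trace semantics with valuations -/

/-- `AcceptsIn E n P Γ tr`: under the valuation `Γ` of its free variables, `P` performs `tr`, as
witnessed by a derivation of depth at most `n`. -/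
def AcceptsIn (E : Defns S) {T : Type} :
    ℕ → {A : Type} → Proc S A → (A → T) → List (Event S T) → Prop
  | 0, _, _, _, tr => tr = []
  | _ + 1, _, .STOP, _, tr => tr = []
  | n + 1, _, .pre c ds ts k, Γ, tr => tr = [] ∨
      ∃ (d : S.DPos c → S.Val) (v : S.TPos c → T) (tr' : List (Event S T)),
        tr = ⟨c, d, v⟩ :: tr' ∧ (∀ i, (ds i).Fits d i) ∧ (∀ i, ((ts i).map Γ).Fits (v i)) ∧
          AcceptsIn E n (k d) (Sum.elim Γ fun i => v i.1) tr'
  | n + 1, _, .ext P Q, Γ, tr => AcceptsIn E n P Γ tr ∨ AcceptsIn E n Q Γ tr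
  | n + 1, _, .int P Q, Γ, tr => AcceptsIn E n P Γ tr ∨ AcceptsIn E n Q Γ tr
  | n + 1, _, .slide P Q, Γ, tr => AcceptsIn E n P Γ tr ∨ AcceptsIn E n Q Γ tr
  | n + 1, _, .ifT g P Q, Γ, tr =>
      (g.map Γ).Holds ∧ AcceptsIn E n P Γ tr ∨ ¬ (g.map Γ).Holds ∧ AcceptsIn E n Q Γ tr
  | n + 1, _, .ifD b P Q, Γ, tr => b ∧ AcceptsIn E n P Γ tr ∨ ¬ b ∧ AcceptsIn E n Q Γ tr
  | n + 1, _, .call X args, Γ, tr => AcceptsIn E n (E X) (fun i => Γ (args i)) tr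

/-- Under the valuation `Γ` of its free variables, `P` performs the trace `tr`. -/
def Accepts (E : Defns S) {T A : Type} (P : Proc S A) (Γ : A → T) (tr : List (Event S T)) : Prop :=
  ∃ n, AcceptsIn E n P Γ tr

theorem accepts_nil (E : Defns S) {T A : Type} (P : Proc S A) (Γ : A → T) : Accepts E P Γ [] :=
  ⟨0, rfl⟩

/-! ### Functoriality of substitution -/

theorem TField.map_map {A B C : Type} (f : A → B) (g : B → C) (x : TField A) :
    (x.map f).map g = x.map (g ∘ f) := by
  cases x <;> rfl

theorem TField.map_id {A : Type} (x : TField A) : x.map id = x := by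
  cases x <;> rfl

theorem TCond.map_map {A B C : Type} (f : A → B) (g : B → C) (x : TCond A) :
    (x.map f).map g = x.map (g ∘ f) := by
  induction x <;> simp_all [TCond.map]

theorem TCond.map_id {A : Type} (x : TCond A) : x.map id = x := by
  induction x <;> simp_all [TCond.map]

/-- The type of the continuation depends on `ts`, so rewriting `ts` requires a transport of bound
variables. The hypothesis `hid` is the induction hypothesis of `Proc.map_id`. -/
theorem Proc.pre_eq_of_eq {A : Type} {c : S.Chan} {ds : S.DPos c → DField S c}
    {ts ts' : S.TPos c → TField A} (h : ts = ts') {k : (S.DPos c → S.Val) → Proc S (A ⊕ Bound ts)}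
    {k' : (S.DPos c → S.Val) → Proc S (A ⊕ Bound ts')} (hid : ∀ d, (k d).map id = k d)
    (hk : ∀ d, k' d = (k d).map (Sum.map id fun i => ⟨i.1, h ▸ i.2⟩)) :
    Proc.pre c ds ts k = Proc.pre c ds ts' k' := by
  subst h
  congr 1
  funext d
  rw [hk d]
  exact (hid d).symm.trans (congrArg (fun f => (k d).map f) Sum.map_id_id.symm)

theorem Proc.map_id {A : Type} (P : Proc S A) : P.map id = P := by
  induction P with
  | pre c ds ts k ih =>
    exact (Proc.pre_eq_of_eq (funext fun i => (ts i).map_id.symm) ih fun d => rfl).symm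
  | STOP => rfl
  | ext P Q ihP ihQ => rw [Proc.map, ihP, ihQ]
  | int P Q ihP ihQ => rw [Proc.map, ihP, ihQ]
  | slide P Q ihP ihQ => rw [Proc.map, ihP, ihQ]
  | ifT g P Q ihP ihQ => rw [Proc.map, ihP, ihQ, TCond.map_id]
  | ifD b P Q ihP ihQ => rw [Proc.map, ihP, ihQ]
  | call X args => rfl

/-- Substitution changes no constructor of the term, so the depth is preserved; inductions on depth
can therefore pass through substitutions. -/
theorem acceptsIn_map (E : Defns S) {T : Type} (n : ℕ) {A B : Type} (f : A → B) (P : Proc S A)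
    (Γ : B → T) (tr : List (Event S T)) :
    AcceptsIn E n (P.map f) Γ tr ↔ AcceptsIn E n P (Γ ∘ f) tr := by
  induction n generalizing A B tr with
  | zero => rfl
  | succ n ih =>
    cases P <;>
      simp only [Proc.map, AcceptsIn, ih, TField.map_map, TCond.map_map, Sum.elim_comp_map] <;> rfl

theorem accepts_map (E : Defns S) {T A B : Type} (f : A → B) (P : Proc S A) (Γ : B → T)
    (tr : List (Event S T)) : Accepts E (P.map f) Γ tr ↔ Accepts E P (Γ ∘ f) tr :=
  exists_congr fun n => acceptsIn_map E n f P Γ tr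

/-! ## Agreement with the operational semantics -/

theorem DField.fits_of_resolve {c : S.Chan} {x : DField S c} {d d' : S.DPos c → S.Val}
    {i : S.DPos c} (h : x.IsNd → x.Fits d i) (h' : (x.resolve (d i)).Fits d' i) :
    x.Fits d' i := by
  cases x
  · have : d' i = d i := h'
    simpa [Fits, this] using h trivial
  · exact h'
  · exact h'

theorem DField.resolve_fits {c : S.Chan} {x : DField S c} {d : S.DPos c → S.Val}
    {i : S.DPos c} (h : x.Fits d i) : (x.resolve (d i)).Fits d i := by
  cases x
  · rfl
  · exact h
  · exact h

theorem DField.not_isNd_resolve {c : S.Chan} (x : DField S c) (w : S.Val) :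
    ¬ (x.resolve w).IsNd := by
  cases x <;> simp [resolve, IsNd]

theorem TField.fits_of_resolve {A : Type} {x : TField A} {w w' : A}
    (h : (x.resolve w).Fits w') : x.Fits w' := by
  cases x <;> trivial

theorem TField.resolve_fits {A : Type} {x : TField A} {w : A} (h : x.Fits w) :
    (x.resolve w).Fits w := by
  cases x <;> first | rfl | exact h

theorem TField.not_isNd_resolve {A : Type} (x : TField A) (w : A) : ¬ (x.resolve w).IsNd := by
  cases x <;> simp [resolve, IsNd]

/-- A selection resolved to `v i` has become an output, and fitting it forces `w i = v i`. Binding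
before or after resolution thus gives the same value. -/
theorem elim_comp_resolveVar {T : Type} {c : S.Chan} (ts : S.TPos c → TField T)
    {v w : S.TPos c → T} (h : ∀ i, ((ts i).resolve (v i)).Fits (w i)) :
    (Sum.elim id fun i => w i.1) ∘ resolveVar ts v = Sum.elim id fun i : Bound ts => w i.1 := by
  funext x
  rcases x with a | ⟨i, hi⟩
  · rfl
  · by_cases hr : ((ts i).resolve (v i)).IsOut
    · have hw := h i
      simp only [Function.comp, resolveVar, hr, dite_true, Sum.elim_inl, Sum.elim_inr, id]
      cases hts : ts i <;> simp_all [TField.resolve, TField.Fits, TField.IsOut]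
    · simp [resolveVar, hr]

section Traces

variable {E : Defns S} {T : Type}

/-! ### Acceptance for each operator -/

theorem accepts_ext_iff {A : Type} {P Q : Proc S A} {Γ : A → T} {tr : List (Event S T)} :
    Accepts E (.ext P Q) Γ tr ↔ Accepts E P Γ tr ∨ Accepts E Q Γ tr := by
  constructor
  · rintro ⟨_ | n, h⟩
    · exact .inl ⟨0, h⟩
    · exact h.imp (⟨n, ·⟩) (⟨n, ·⟩)
  · rintro (⟨n, h⟩ | ⟨n, h⟩)
    · exact ⟨n + 1, .inl h⟩
    · exact ⟨n + 1, .inr h⟩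

theorem accepts_int_iff {A : Type} {P Q : Proc S A} {Γ : A → T} {tr : List (Event S T)} :
    Accepts E (.int P Q) Γ tr ↔ Accepts E P Γ tr ∨ Accepts E Q Γ tr := by
  constructor
  · rintro ⟨_ | n, h⟩
    · exact .inl ⟨0, h⟩
    · exact h.imp (⟨n, ·⟩) (⟨n, ·⟩)
  · rintro (⟨n, h⟩ | ⟨n, h⟩)
    · exact ⟨n + 1, .inl h⟩
    · exact ⟨n + 1, .inr h⟩

theorem accepts_slide_iff {A : Type} {P Q : Proc S A} {Γ : A → T} {tr : List (Event S T)} :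
    Accepts E (.slide P Q) Γ tr ↔ Accepts E P Γ tr ∨ Accepts E Q Γ tr := by
  constructor
  · rintro ⟨_ | n, h⟩
    · exact .inl ⟨0, h⟩
    · exact h.imp (⟨n, ·⟩) (⟨n, ·⟩)
  · rintro (⟨n, h⟩ | ⟨n, h⟩)
    · exact ⟨n + 1, .inl h⟩
    · exact ⟨n + 1, .inr h⟩

theorem accepts_ifT_of_holds {A : Type} {g : TCond A} {P Q : Proc S A} {Γ : A → T}
    {tr : List (Event S T)} (hg : (g.map Γ).Holds) :
    Accepts E (.ifT g P Q) Γ tr ↔ Accepts E P Γ tr := by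
  constructor
  · rintro ⟨_ | n, h⟩
    · exact ⟨0, h⟩
    · exact h.elim (fun h => ⟨n, h.2⟩) fun h => absurd hg h.1
  · rintro ⟨n, h⟩
    exact ⟨n + 1, .inl ⟨hg, h⟩⟩

theorem accepts_ifT_of_not_holds {A : Type} {g : TCond A} {P Q : Proc S A} {Γ : A → T}
    {tr : List (Event S T)} (hg : ¬ (g.map Γ).Holds) :
    Accepts E (.ifT g P Q) Γ tr ↔ Accepts E Q Γ tr := by
  constructor
  · rintro ⟨_ | n, h⟩
    · exact ⟨0, h⟩
    · exact h.elim (fun h => absurd h.1 hg) fun h => ⟨n, h.2⟩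
  · rintro ⟨n, h⟩
    exact ⟨n + 1, .inr ⟨hg, h⟩⟩

theorem accepts_ifD_of_holds {A : Type} {b : Prop} {P Q : Proc S A} {Γ : A → T}
    {tr : List (Event S T)} (hb : b) :
    Accepts E (.ifD b P Q) Γ tr ↔ Accepts E P Γ tr := by
  constructor
  · rintro ⟨_ | n, h⟩
    · exact ⟨0, h⟩
    · exact h.elim (fun h => ⟨n, h.2⟩) fun h => absurd hb h.1
  · rintro ⟨n, h⟩
    exact ⟨n + 1, .inl ⟨hb, h⟩⟩

theorem accepts_ifD_of_not_holds {A : Type} {b : Prop} {P Q : Proc S A} {Γ : A → T}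
    {tr : List (Event S T)} (hb : ¬ b) :
    Accepts E (.ifD b P Q) Γ tr ↔ Accepts E Q Γ tr := by
  constructor
  · rintro ⟨_ | n, h⟩
    · exact ⟨0, h⟩
    · exact h.elim (fun h => absurd h.1 hb) fun h => ⟨n, h.2⟩
  · rintro ⟨n, h⟩
    exact ⟨n + 1, .inr ⟨hb, h⟩⟩

theorem accepts_call_iff {A : Type} {X : S.Ident} {args : Fin (S.params X) → A} {Γ : A → T}
    {tr : List (Event S T)} :
    Accepts E (.call X args) Γ tr ↔ Accepts E (E X) (Γ ∘ args) tr := by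
  constructor
  · rintro ⟨_ | n, h⟩
    · exact ⟨0, h⟩
    · exact ⟨n, h⟩
  · rintro ⟨n, h⟩
    exact ⟨n + 1, h⟩

theorem accepts_pre_iff {A : Type} {c : S.Chan} {ds : S.DPos c → DField S c}
    {ts : S.TPos c → TField A} {k : (S.DPos c → S.Val) → Proc S (A ⊕ Bound ts)} {Γ : A → T}
    {tr : List (Event S T)} :
    Accepts E (.pre c ds ts k) Γ tr ↔ tr = [] ∨
      ∃ (d : S.DPos c → S.Val) (v : S.TPos c → T) (tr' : List (Event S T)),
        tr = ⟨c, d, v⟩ :: tr' ∧ (∀ i, (ds i).Fits d i) ∧ (∀ i, ((ts i).map Γ).Fits (v i)) ∧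
          Accepts E (k d) (Sum.elim Γ fun i => v i.1) tr' := by
  constructor
  · rintro ⟨_ | n, h⟩
    · exact .inl h
    · exact h.imp id fun ⟨d, v, tr', h₁, h₂, h₃, h₄⟩ => ⟨d, v, tr', h₁, h₂, h₃, n, h₄⟩
  · rintro (rfl | ⟨d, v, tr', h₁, h₂, h₃, n, h₄⟩)
    · exact accepts_nil E _ _
    · exact ⟨n + 1, .inr ⟨d, v, tr', h₁, h₂, h₃, h₄⟩⟩

/-- Soundness: acceptance is pulled back along a transition, so operational traces are accepted. -/
theorem Step.accepts {P P' : Proc S T} {l : Option (Event S T)} (h : Step E P l P')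
    {tr : List (Event S T)} (hA : Accepts E P' id tr) : Accepts E P id (l.toList ++ tr) := by
  induction h with
  | event d v _ _ hd hv =>
    refine accepts_pre_iff.2 (.inr ⟨d, v, tr, rfl, hd, fun i => ?_, ?_⟩)
    · rw [TField.map_id]
      exact hv i
    · rwa [accepts_map, Function.id_comp] at hA
  | selectD d _ hd =>
    refine accepts_pre_iff.2 ((accepts_pre_iff.1 hA).imp id ?_)
    rintro ⟨d', v, tr', rfl, h₁, h₂, h₃⟩
    exact ⟨d', v, tr', rfl, fun i => (DField.fits_of_resolve (hd i) (h₁ i)), h₂, h₃⟩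
  | selectT v _ _ =>
    refine accepts_pre_iff.2 ((accepts_pre_iff.1 hA).imp id ?_)
    rintro ⟨d', w, tr', rfl, h₁, h₂, h₃⟩
    simp only [TField.map_id] at h₂
    refine ⟨d', w, tr', rfl, h₁, fun i => ?_, ?_⟩
    · rw [TField.map_id]
      exact TField.fits_of_resolve (h₂ i)
    · rw [accepts_map, elim_comp_resolveVar _ h₂] at h₃
      exact h₃
  | extTauL _ ih => exact accepts_ext_iff.2 ((accepts_ext_iff.1 hA).imp ih id)
  | extTauR _ ih => exact accepts_ext_iff.2 ((accepts_ext_iff.1 hA).imp id ih)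
  | extL _ ih => exact accepts_ext_iff.2 (.inl (ih hA))
  | extR _ ih => exact accepts_ext_iff.2 (.inr (ih hA))
  | intL => exact accepts_int_iff.2 (.inl hA)
  | intR => exact accepts_int_iff.2 (.inr hA)
  | slideTimeout => exact accepts_slide_iff.2 (.inr hA)
  | slideTau _ ih => exact accepts_slide_iff.2 ((accepts_slide_iff.1 hA).imp ih id)
  | slideVis _ ih => exact accepts_slide_iff.2 (.inl (ih hA))
  | ifTTrue hg _ ih => exact (accepts_ifT_of_holds (by rwa [TCond.map_id])).2 (ih hA)
  | ifTFalse hg _ ih => exact (accepts_ifT_of_not_holds (by rwa [TCond.map_id])).2 (ih hA)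
  | ifDTrue hb _ ih => exact (accepts_ifD_of_holds hb).2 (ih hA)
  | ifDFalse hb _ ih => exact (accepts_ifD_of_not_holds hb).2 (ih hA)
  | call => exact accepts_call_iff.2 ((accepts_map ..).1 hA)

/-! ### Operational traces and acceptance coincide -/

/-- The process `P` performs the trace `tr`. -/
inductive Performs (E : Defns S) {T : Type} : Proc S T → List (Event S T) → Prop
  | nil (P : Proc S T) : Performs E P []
  | tau {P P' : Proc S T} {tr : List (Event S T)} :
      Step E P none P' → Performs E P' tr → Performs E P tr
  | vis {P P' : Proc S T} {e : Event S T} {tr : List (Event S T)} :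
      Step E P (some e) P' → Performs E P' tr → Performs E P (e :: tr)

theorem mem_traces_iff_performs {P : Proc S T} {tr : List (Event S T)} :
    tr ∈ (P.lts E).traces ↔ Performs E P tr := by
  constructor
  · rintro ⟨s, hs⟩
    suffices ∀ Q : (P.lts E).State, (P.lts E).Weak Q tr s → Performs E Q tr from this _ hs
    intro Q h
    clear hs
    induction h with
    | refl => exact .nil _
    | tau hs _ ih => exact .tau hs ih
    | vis hs _ ih => exact .vis hs ih
  · intro h
    -- The term `R` only fixes the initial state of the system; it is separated from the current
    -- state `Q`, which changes along the run.
    suffices ∀ R Q : Proc S T, Performs E Q tr → ∃ s, (R.lts E).Weak Q tr s from this P P h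
    intro R Q h
    clear * - h
    induction h with
    | nil => exact ⟨_, .refl _⟩
    | tau hs _ ih => exact ih.imp fun _ => .tau hs
    | vis hs _ ih => exact ih.imp fun _ => .vis hs

theorem Performs.accepts {P : Proc S T} {tr : List (Event S T)} (h : Performs E P tr) :
    Accepts E P id tr := by
  induction h with
  | nil => exact accepts_nil E _ _
  | tau hs _ ih => exact hs.accepts ih
  | vis hs _ ih => exact hs.accepts ih

theorem Performs.extL {P : Proc S T} (Q : Proc S T) {tr : List (Event S T)}
    (h : Performs E P tr) : Performs E (.ext P Q) tr := by
  induction h with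
  | nil => exact .nil _
  | tau hs _ ih => exact .tau (.extTauL hs) ih
  | vis hs hP _ => exact .vis (.extL hs) hP

theorem Performs.extR (P : Proc S T) {Q : Proc S T} {tr : List (Event S T)}
    (h : Performs E Q tr) : Performs E (.ext P Q) tr := by
  induction h with
  | nil => exact .nil _
  | tau hs _ ih => exact .tau (.extTauR hs) ih
  | vis hs hP _ => exact .vis (.extR hs) hP

theorem Performs.slideL {P : Proc S T} (Q : Proc S T) {tr : List (Event S T)}
    (h : Performs E P tr) : Performs E (.slide P Q) tr := by
  induction h with
  | nil => exact .nil _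
  | tau hs _ ih => exact .tau (.slideTau hs) ih
  | vis hs hP _ => exact .vis (.slideVis hs) hP

theorem Performs.of_step_imp {P Q : Proc S T} (hPQ : ∀ l P', Step E P l P' → Step E Q l P')
    {tr : List (Event S T)} (h : Performs E P tr) : Performs E Q tr := by
  cases h with
  | nil => exact .nil _
  | tau hs hP => exact .tau (hPQ _ _ hs) hP
  | vis hs hP => exact .vis (hPQ _ _ hs) hP

/-- The state reached after the event has a different syntactic form according to whether a
selection over `t` came first. Hence `hk` asks only that it accept whatever `k d` accepts, depth by
depth. -/
theorem performs_pre_of_not_nd {c : S.Chan} {ds : S.DPos c → DField S c}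
    {ts : S.TPos c → TField T} {k : (S.DPos c → S.Val) → Proc S (T ⊕ Bound ts)}
    (hnd : ∀ i, ¬ (ds i).IsNd) {d : S.DPos c → S.Val} {v : S.TPos c → T}
    (hd : ∀ i, (ds i).Fits d i) (hv : ∀ i, (ts i).Fits (v i)) {tr : List (Event S T)}
    (hk : ∀ P, (∀ n, AcceptsIn E n (k d) (Sum.elim id fun i => v i.1) tr →
      AcceptsIn E n P id tr) → Performs E P tr) :
    Performs E (.pre c ds ts k) (⟨c, d, v⟩ :: tr) := by
  by_cases hts : ∃ i, (ts i).IsNd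
  · refine .tau (.selectT v hnd hts) (.vis (.event d v hnd (fun i => TField.not_isNd_resolve _ _)
      hd fun i => TField.resolve_fits (hv i)) (hk _ fun n hn => ?_))
    rw [acceptsIn_map, acceptsIn_map, Function.id_comp,
      elim_comp_resolveVar _ fun i => TField.resolve_fits (hv i)]
    exact hn
  · push Not at hts
    refine .vis (.event d v hnd hts hd hv) (hk _ fun n hn => ?_)
    rw [acceptsIn_map]
    exact hn

/-- Completeness. The induction is on depth, since a call unfolds to a term that is not structurally
smaller. -/
theorem performs_of_acceptsIn (n : ℕ) {P : Proc S T} {tr : List (Event S T)}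
    (h : AcceptsIn E n P id tr) : Performs E P tr := by
  induction n generalizing P tr with
  | zero =>
    have : tr = [] := h
    subst this
    exact .nil _
  | succ n ih =>
    cases P with
    | STOP =>
      have : tr = [] := h
      subst this
      exact .nil _
    | pre c ds ts k =>
      rcases h with rfl | ⟨d, v, tr, rfl, hd, hv, hk⟩
      · exact .nil _
      simp only [TField.map_id] at hv
      have hk' : ∀ P, (∀ n, AcceptsIn E n (k d) (Sum.elim id fun i => v i.1) tr →
          AcceptsIn E n P id tr) → Performs E P tr := fun P hP => ih (hP n hk)
      by_cases hnd : ∃ i, (ds i).IsNd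
      · exact .tau (.selectD d hnd fun i _ => hd i) (performs_pre_of_not_nd
          (fun i => DField.not_isNd_resolve _ _) (fun i => DField.resolve_fits (hd i)) hv hk')
      · push Not at hnd
        exact performs_pre_of_not_nd hnd hd hv hk'
    | ext P Q => exact h.elim (fun h => (ih h).extL Q) fun h => (ih h).extR P
    | int P Q => exact h.elim (fun h => .tau .intL (ih h)) fun h => .tau .intR (ih h)
    | slide P Q => exact h.elim (fun h => (ih h).slideL Q) fun h => .tau .slideTimeout (ih h)
    | ifT g P Q =>
      simp only [AcceptsIn, TCond.map_id] at h
      rcases h with ⟨hg, h⟩ | ⟨hg, h⟩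
      · exact (ih h).of_step_imp fun _ _ => .ifTTrue hg
      · exact (ih h).of_step_imp fun _ _ => .ifTFalse hg
    | ifD b P Q =>
      rcases h with ⟨hb, h⟩ | ⟨hb, h⟩
      · exact (ih h).of_step_imp fun _ _ => .ifDTrue hb
      · exact (ih h).of_step_imp fun _ _ => .ifDFalse hb
    | call X args => exact .tau .call (ih ((acceptsIn_map ..).2 h))

theorem mem_traces_map_iff {A : Type} (P : Proc S A) (Γ : A → T) (tr : List (Event S T)) :
    tr ∈ ((P.map Γ).lts E).traces ↔ Accepts E P Γ tr := by
  rw [← Function.id_comp Γ, ← accepts_map, Function.id_comp]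
  rw [mem_traces_iff_performs]
  exact ⟨Performs.accepts, fun ⟨n, h⟩ => performs_of_acceptsIn n h⟩

/-- With disjoint channels, this lets the first event decide which side of a choice a run takes. -/
theorem hasChannel_of_acceptsIn (n : ℕ) {A : Type} {P : Proc S A} {Γ : A → T} {e : Event S T}
    {tr : List (Event S T)} (h : AcceptsIn E n P Γ (e :: tr)) : HasChannel E P e.chan := by
  induction n generalizing A with
  | zero => cases h
  | succ n ih =>
    cases P with
    | STOP => cases h
    | pre c ds ts k =>
      rcases h with h | ⟨d, v, tr', h, -⟩
      · cases h
      · cases h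
        exact .pre
    | ext P Q => exact h.elim (fun h => .extL (ih h)) fun h => .extR (ih h)
    | int P Q => exact h.elim (fun h => .intL (ih h)) fun h => .intR (ih h)
    | slide P Q => exact h.elim (fun h => .slideL (ih h)) fun h => .slideR (ih h)
    | ifT g P Q => exact h.elim (fun h => .ifTThen (ih h.2)) fun h => .ifTElse (ih h.2)
    | ifD b P Q => exact h.elim (fun h => .ifDThen (ih h.2)) fun h => .ifDElse (ih h.2)
    | call X args => exact .call (ih h)

theorem Accepts.hasChannel {A : Type} {P : Proc S A} {Γ : A → T} {e : Event S T}
    {tr : List (Event S T)} (h : Accepts E P Γ (e :: tr)) : HasChannel E P e.chan :=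
  h.elim fun n => hasChannel_of_acceptsIn n

end Traces

/-! ## Output positions along symbolic traces -/

section OutputsIn

variable {E : Defns S}

/-- What an event shows outside type `t`. -/
def Event.nonT {T : Type} (e : Event S T) : (c : S.Chan) × (S.DPos c → S.Val) := ⟨e.chan, e.data⟩

/-- Every symbolic trace of `P` with the channels and data `w` outputs values of type `t` in its
last event at positions in `D` only. -/
def OutputsIn (E : Defns S) {A : Type} (P : Proc S A) (w : List ((c : S.Chan) × (S.DPos c → S.Val)))
    (D : Set ℕ) : Prop :=
  ∀ (σ : List (SymLabel S)) (B : Type) (ε : SymEvent S B), SymTrace E P (σ ++ [.vis ε]) →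
    (σ ++ [SymLabel.vis ε]).filterMap SymLabel.nonT = w → ε.outT ⊆ D

theorem SymLabel.nonT_ofSilent {A : Type} (l : Option (TCond A)) :
    (SymLabel.ofSilent l : SymLabel S).nonT = none := by
  cases l <;> rfl

/-- Silent labels are invisible to non-`t` equivalence. As conditional moves ignore satisfiability,
one `D` serves both branches of a conditional. -/
theorem OutputsIn.of_silentStep {A : Type} {P P' : Proc S A} {l : Option (TCond A)}
    {w : List ((c : S.Chan) × (S.DPos c → S.Val))} {D : Set ℕ} (hs : SilentStep E P l P')
    (h : OutputsIn E P w D) : OutputsIn E P' w D := by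
  intro σ B ε hσ hw
  refine h (SymLabel.ofSilent l :: σ) B ε (.silent hs hσ) ?_
  rw [List.cons_append, List.filterMap_cons, SymLabel.nonT_ofSilent]
  exact hw

theorem OutputsIn.of_visStep {A : Type} {P : Proc S A} {ε : SymEvent S A}
    {P' : Proc S (A ⊕ Bound ε.fld)} {w : List ((c : S.Chan) × (S.DPos c → S.Val))} {D : Set ℕ}
    (hs : VisStep E P ε P') (h : OutputsIn E P (⟨ε.chan, ε.data⟩ :: w) D) :
    OutputsIn E P' w D := by
  intro σ B ε' hσ hw
  refine h (SymLabel.vis ε :: σ) B ε' (.vis hs hσ) ?_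
  rw [List.cons_append, List.filterMap_cons]
  simp only [SymLabel.nonT, hw]

theorem OutputsIn.outT_subset {A : Type} {P : Proc S A} {ε : SymEvent S A}
    {P' : Proc S (A ⊕ Bound ε.fld)} {D : Set ℕ} (hs : VisStep E P ε P')
    (h : OutputsIn E P [⟨ε.chan, ε.data⟩] D) : ε.outT ⊆ D :=
  h [] A ε (.vis hs (.nil _)) rfl

/-- If every symbolic trace of `Q` that ends with a visible event is one of `P`, then `Q` outputs
at no more positions than `P`. -/
theorem OutputsIn.of_symTrace_imp {A : Type} {P Q : Proc S A}
    {w : List ((c : S.Chan) × (S.DPos c → S.Val))} {D : Set ℕ}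
    (hQP : ∀ σ, σ ≠ [] → SymTrace E Q σ → SymTrace E P σ) (h : OutputsIn E P w D) :
    OutputsIn E Q w D :=
  fun σ B ε hσ hw => h σ B ε (hQP _ (by simp) hσ) hw

/-- A context `C` that silent transitions preserve and visible transitions resolve inherits the
symbolic traces of the process in it. -/
theorem SymTrace.context {A : Type} (C : Proc S A → Proc S A)
    (hs : ∀ P l P', SilentStep E P l P' → SilentStep E (C P) l (C P'))
    (hv : ∀ P (ε : SymEvent S A) P', VisStep E P ε P' → VisStep E (C P) ε P')
    {P : Proc S A} {σ : List (SymLabel S)} (h : SymTrace E P σ) : SymTrace E (C P) σ := by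
  induction h with
  | nil => exact .nil _
  | silent h _ ih => exact .silent (hs _ _ _ h) (ih C hs hv)
  | vis h hσ _ => exact .vis (hv _ _ _ h) hσ

theorem SymTrace.of_step_imp {A : Type} {P Q : Proc S A}
    (hs : ∀ l P', SilentStep E P l P' → SilentStep E Q l P')
    (hv : ∀ (ε : SymEvent S A) P', VisStep E P ε P' → VisStep E Q ε P')
    {σ : List (SymLabel S)} (h : SymTrace E P σ) : SymTrace E Q σ := by
  cases h with
  | nil => exact .nil _
  | silent h hσ => exact .silent (hs _ _ h) hσ
  | vis h hσ => exact .vis (hv _ _ h) hσ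

variable {A : Type} {P Q : Proc S A} {w : List ((c : S.Chan) × (S.DPos c → S.Val))} {D : Set ℕ}

theorem OutputsIn.extL (h : OutputsIn E (.ext P Q) w D) : OutputsIn E P w D :=
  h.of_symTrace_imp fun _ _ => SymTrace.context (.ext · Q) (fun _ _ _ => .extL) fun _ _ _ => .extL

theorem OutputsIn.extR (h : OutputsIn E (.ext P Q) w D) : OutputsIn E Q w D :=
  h.of_symTrace_imp fun _ _ => SymTrace.context (.ext P) (fun _ _ _ => .extR) fun _ _ _ => .extR

theorem OutputsIn.slideL (h : OutputsIn E (.slide P Q) w D) : OutputsIn E P w D :=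
  h.of_symTrace_imp fun _ _ =>
    SymTrace.context (.slide · Q) (fun _ _ _ => .slide) fun _ _ _ => .slide

theorem OutputsIn.ifDThen {b : Prop} (hb : b) (h : OutputsIn E (.ifD b P Q) w D) :
    OutputsIn E P w D :=
  h.of_symTrace_imp fun _ _ =>
    SymTrace.of_step_imp (fun _ _ => .ifDTrue hb) fun _ _ => .ifDTrue hb

theorem OutputsIn.ifDElse {b : Prop} (hb : ¬ b) (h : OutputsIn E (.ifD b P Q) w D) :
    OutputsIn E Q w D :=
  h.of_symTrace_imp fun _ _ =>
    SymTrace.of_step_imp (fun _ _ => .ifDFalse hb) fun _ _ => .ifDFalse hb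

/-- After resolving its selections outside type `t`, a prefix performs its symbolic event. -/
theorem OutputsIn.exists_visStep {c : S.Chan} {ds : S.DPos c → DField S c}
    {ts : S.TPos c → TField A} {k : (S.DPos c → S.Val) → Proc S (A ⊕ Bound ts)}
    {d : S.DPos c → S.Val} (hd : ∀ i, (ds i).Fits d i)
    (h : OutputsIn E (.pre c ds ts k) w D) :
    ∃ P, VisStep E P ⟨c, d, ts⟩ (k d) ∧ OutputsIn E P w D := by
  by_cases hnd : ∃ i, (ds i).IsNd
  · exact ⟨_, .event d (fun i => DField.not_isNd_resolve _ _)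
      fun i => DField.resolve_fits (hd i), h.of_silentStep (.selectD d hnd fun i _ => hd i)⟩
  · push Not at hnd
    exact ⟨_, .event d hnd hd, h⟩

end OutputsIn

/-! ## Lifting traces along a collapsing function -/

section Lifting

/-- Any function preserves equalities, hence conjunctions of them. -/
theorem TCond.IsPosConj.holds_map_comp {A B C : Type} {Γ : A → B} {f : B → C} {g : TCond A}
    (hg : g.IsPosConj) (h : (g.map Γ).Holds) : (g.map (f ∘ Γ)).Holds := by
  induction g with
  | eq a b => exact congrArg f h
  | not => exact hg.elim
  | and g₁ g₂ ih₁ ih₂ => exact ⟨ih₁ hg.1 h.1, ih₂ hg.2 h.2⟩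
  | or => exact hg.elim

variable {E : Defns S} {Spec : Proc S Empty}

/-- The positive branch of a conditional choice on `t` performs no other traces than the negative
branch. -/
theorem RevPosConjEqT.accepts {n : ℕ} (hn : 0 < n) (hRev : RevPosConjEqT E Spec) {A : Type}
    {g : TCond A} {P Q : Proc S A} (hW : Within E Spec (.ifT g P Q)) {Γ : A → Fin n}
    {tr : List (Event S (Fin n))} (h : Accepts E P Γ tr) : Accepts E Q Γ tr :=
  (mem_traces_map_iff ..).1 ((hRev _ _ _ _ hW).2 n hn Γ ((mem_traces_map_iff ..).2 h))

variable {n m : ℕ} {f : Fin n → Fin m}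

/-- An event is possible if its image under `f` is, and `f` identifies no value that the event
carries at an output position with another one. -/
theorem accepts_singleton_of_map (hn : 0 < n) (hRev : RevPosConjEqT E Spec) {D : Set ℕ}
    {e : Event S (Fin n)}
    (hf : ∀ i : S.TPos e.chan, (i.1 : ℕ) ∈ D → ∀ w, f w = f (e.tval i) → w = e.tval i)
    (N : ℕ) {A B : Type} {P : Proc S A} (hW : Within E Spec P) {Γ : A → Fin n} {ρ : A → B}
    (hD : OutputsIn E (P.map ρ) [e.nonT] D) (h : AcceptsIn E N P (f ∘ Γ) [e.map f]) :
    Accepts E P Γ [e] := by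
  induction N generalizing A B with
  | zero => cases h
  | succ N ih =>
    cases P with
    | STOP => cases h
    | pre c ds ts k =>
      obtain ⟨c', d', v'⟩ := e
      rcases h with h | ⟨d, v, tr', h, hd, hv, -⟩
      · cases h
      simp only [Event.map, List.cons.injEq, Event.mk.injEq] at h
      obtain ⟨⟨rfl, h₁, h₂⟩, rfl⟩ := h
      obtain rfl := eq_of_heq h₁
      obtain rfl := eq_of_heq h₂
      refine accepts_pre_iff.2 (.inr ⟨d', v', [], rfl, hd, fun i => ?_, accepts_nil _ _ _⟩)
      obtain ⟨P', hs, hP'⟩ := OutputsIn.exists_visStep hd hD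
      -- The construct itself is the last symbolic event, so its outputs lie in `D`.
      have hi : ((ts i).map ρ).IsOut → (i.1 : ℕ) ∈ D := fun hi => hP'.outT_subset hs ⟨i, hi, rfl⟩
      have hvi := hv i
      cases hts : ts i with
      | nd => trivial
      | inp => trivial
      | out a =>
        rw [hts] at hi hvi
        -- The image run yields only `f (Γ a) = f (e.tval i)`; membership in `D` allows `f` to be
        -- cancelled.
        exact (hf i (hi trivial) (Γ a) hvi.symm).symm
    | ext P Q =>
      refine accepts_ext_iff.2 (h.imp ?_ ?_)
      · exact ih hW.extL hD.extL
      · exact ih hW.extR hD.extR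
    | int P Q =>
      refine accepts_int_iff.2 (h.imp ?_ ?_)
      · exact ih hW.intL (hD.of_silentStep .intL)
      · exact ih hW.intR (hD.of_silentStep .intR)
    | slide P Q =>
      refine accepts_slide_iff.2 (h.imp ?_ ?_)
      · exact ih hW.slideL hD.slideL
      · exact ih hW.slideR (hD.of_silentStep .slideTimeout)
    | ifT g P Q =>
      have hP : AcceptsIn E N P (f ∘ Γ) [e.map f] → Accepts E P Γ [e] :=
        ih hW.ifTThen (hD.of_silentStep .ifTThen)
      have hQ : AcceptsIn E N Q (f ∘ Γ) [e.map f] → Accepts E Q Γ [e] :=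
        ih hW.ifTElse (hD.of_silentStep .ifTElse)
      by_cases hg : (g.map Γ).Holds
      · refine (accepts_ifT_of_holds hg).2 (hP ?_)
        exact (h.resolve_right fun h => h.1 ((hRev _ _ _ _ hW).1.holds_map_comp hg)).2
      -- The guard may have become true under `f`. In that case the event is lifted in the positive
      -- branch first, and refinement at size `n` then carries it to the negative one.
      · exact (accepts_ifT_of_not_holds hg).2
          (h.elim (fun h => hRev.accepts hn hW (hP h.2)) fun h => hQ h.2)
    | ifD b P Q =>
      rcases h with ⟨hb, h⟩ | ⟨hb, h⟩
      · exact (accepts_ifD_of_holds hb).2 (ih hW.ifDThen (hD.ifDThen hb) h)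
      · exact (accepts_ifD_of_not_holds hb).2 (ih hW.ifDElse (hD.ifDElse hb) h)
    | call X args => exact accepts_call_iff.2 (ih hW.call (hD.of_silentStep .call) h)

/-- A trace can be extended by an event if the image under `f` of the extended trace is a trace,
and `f` identifies no value that the event carries at an output position with another one. -/
theorem accepts_concat_of_map (hn : 0 < n) (hm : 0 < m) (hNorm : SeqNorm E Spec)
    (hRev : RevPosConjEqT E Spec) {D : Set ℕ} {e : Event S (Fin n)}
    (hf : ∀ i : S.TPos e.chan, (i.1 : ℕ) ∈ D → ∀ w, f w = f (e.tval i) → w = e.tval i)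
    (N : ℕ) {A B : Type} {P : Proc S A} (hW : Within E Spec P) {Γ : A → Fin n} {ρ : A → B}
    {tr : List (Event S (Fin n))}
    (hD : OutputsIn E (P.map ρ) ((tr ++ [e]).map Event.nonT) D)
    (htr : AcceptsIn E N P Γ tr) (h : Accepts E P (f ∘ Γ) ((tr ++ [e]).map (Event.map f))) :
    Accepts E P Γ (tr ++ [e]) := by
  -- The depth bounds the run for `tr` alone; the image run is unbounded and follows it.
  induction N generalizing A B tr with
  | zero =>
    obtain rfl : tr = [] := htr
    exact h.elim fun N => accepts_singleton_of_map hn hRev hf N hW hD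
  | succ N ih =>
    rcases tr with _ | ⟨e₁, tr⟩
    · exact h.elim fun N => accepts_singleton_of_map hn hRev hf N hW hD
    cases P with
    | STOP => cases htr
    | pre c ds ts k =>
      rcases htr with htr | ⟨d, v, tr', htr, hd, hv, hk⟩
      · cases htr
      obtain ⟨rfl, rfl⟩ := List.cons.inj htr
      rcases accepts_pre_iff.1 h with h | ⟨d', v', tr₁, h, -, -, hk'⟩
      · cases h
      simp only [List.cons_append, List.map_cons, Event.map, List.cons.injEq, Event.mk.injEq,
        heq_eq_eq, true_and] at h
      obtain ⟨⟨rfl, rfl⟩, rfl⟩ := h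
      obtain ⟨P', hs, hP'⟩ := OutputsIn.exists_visStep hd hD
      refine accepts_pre_iff.2 (.inr ⟨d, v, tr ++ [e], rfl, hd, hv, ?_⟩)
      refine ih (hW.pre d hd) (hP'.of_visStep hs) hk ?_
      -- The image run binds the `f`-images of the values bound by `e₁`, so its valuation is again
      -- `f` after the other one.
      rw [Sum.comp_elim]
      exact hk'
    | ext P Q =>
      -- `Event.map f` keeps the channel, so `e₁` and its image must come from the same side.
      have hc := ((hNorm _ _ _).1 hW).1 e₁.chan
      rcases htr with htr | htr
      · refine accepts_ext_iff.2 (.inl (ih hW.extL hD.extL htr ?_))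
        exact (accepts_ext_iff.1 h).resolve_right fun h =>
          hc ⟨hasChannel_of_acceptsIn _ htr, Accepts.hasChannel (e := e₁.map f) h⟩
      · refine accepts_ext_iff.2 (.inr (ih hW.extR hD.extR htr ?_))
        exact (accepts_ext_iff.1 h).resolve_left fun h =>
          hc ⟨Accepts.hasChannel (e := e₁.map f) h, hasChannel_of_acceptsIn _ htr⟩
    | int P Q =>
      have hc := ((hNorm _ _ _).2.1 hW).1 e₁.chan
      rcases htr with htr | htr
      · refine accepts_int_iff.2 (.inl (ih hW.intL (hD.of_silentStep .intL) htr ?_))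
        exact (accepts_int_iff.1 h).resolve_right fun h =>
          hc ⟨hasChannel_of_acceptsIn _ htr, Accepts.hasChannel (e := e₁.map f) h⟩
      · refine accepts_int_iff.2 (.inr (ih hW.intR (hD.of_silentStep .intR) htr ?_))
        exact (accepts_int_iff.1 h).resolve_left fun h =>
          hc ⟨Accepts.hasChannel (e := e₁.map f) h, hasChannel_of_acceptsIn _ htr⟩
    | slide P Q =>
      have hc := ((hNorm _ _ _).2.2 hW).1 e₁.chan
      rcases htr with htr | htr
      · refine accepts_slide_iff.2 (.inl (ih hW.slideL hD.slideL htr ?_))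
        exact (accepts_slide_iff.1 h).resolve_right fun h =>
          hc ⟨hasChannel_of_acceptsIn _ htr, Accepts.hasChannel (e := e₁.map f) h⟩
      · refine accepts_slide_iff.2
          (.inr (ih hW.slideR (hD.of_silentStep .slideTimeout) htr ?_))
        exact (accepts_slide_iff.1 h).resolve_left fun h =>
          hc ⟨Accepts.hasChannel (e := e₁.map f) h, hasChannel_of_acceptsIn _ htr⟩
    | ifT g P Q =>
      rcases htr with ⟨hg, htr⟩ | ⟨hg, htr⟩
      · refine (accepts_ifT_of_holds hg).2 (ih hW.ifTThen (hD.of_silentStep .ifTThen) htr ?_)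
        exact (accepts_ifT_of_holds ((hRev _ _ _ _ hW).1.holds_map_comp hg)).1 h
      · refine (accepts_ifT_of_not_holds hg).2
          (ih hW.ifTElse (hD.of_silentStep .ifTElse) htr ?_)
        -- If `f` makes the guard true, the image run is in the wrong branch; refinement at size `m`
        -- moves it before lifting.
        by_cases hg' : (g.map (f ∘ Γ)).Holds
        · exact hRev.accepts hm hW ((accepts_ifT_of_holds hg').1 h)
        · exact (accepts_ifT_of_not_holds hg').1 h
    | ifD b P Q =>
      rcases htr with ⟨hb, htr⟩ | ⟨hb, htr⟩
      · exact (accepts_ifD_of_holds hb).2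
          (ih hW.ifDThen (hD.ifDThen hb) htr ((accepts_ifD_of_holds hb).1 h))
      · exact (accepts_ifD_of_not_holds hb).2
          (ih hW.ifDElse (hD.ifDElse hb) htr ((accepts_ifD_of_not_holds hb).1 h))
    | call X args =>
      exact accepts_call_iff.2
        -- `Within` reaches the definition unsubstituted, whereas symbolic traces see its instance;
        -- the renaming `ρ` absorbs the arguments.
        (ih hW.call (hD.of_silentStep .call) htr ((accepts_call_iff (Γ := f ∘ Γ)).1 h))

end Lifting

/-! ## Renaming and symmetry of the implementation -/

section Symmetry

theorem LTS.Weak.rename {Ev Ev' : Type} {L : LTS.{u} Ev} (f : Ev → Ev') {s s' : L.State}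
    {tr : List Ev} (h : L.Weak s tr s') : (L.rename f).Weak s (tr.map f) s' := by
  induction h with
  | refl => exact .refl _
  | tau hs _ ih => exact .tau ⟨_, hs, rfl⟩ ih
  | vis hs _ ih => exact .vis ⟨_, hs, rfl⟩ ih

theorem LTS.map_mem_traces_rename {Ev Ev' : Type} {L : LTS.{u} Ev} (f : Ev → Ev') {tr : List Ev}
    (h : tr ∈ L.traces) : tr.map f ∈ (L.rename f).traces :=
  h.imp fun _ => Weak.rename f

/-- A run of `M` is simulated step by step using the backward clause. -/
theorem LTS.Bisimilar.traces_subset {Ev : Type} {L M : LTS.{u} Ev}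
    (h : LTS.Bisimilar L M) : M.traces ⊆ L.traces := by
  obtain ⟨R, hR, -, hback⟩ := h
  rintro tr ⟨t, ht⟩
  suffices ∀ t₀ s₀, R s₀ t₀ → M.Weak t₀ tr t → ∃ s, L.Weak s₀ tr s from this _ _ hR ht
  intro t₀ s₀ hR₀ h
  clear ht hR
  induction h generalizing s₀ with
  | refl => exact ⟨_, .refl _⟩
  | tau hs _ ih =>
    obtain ⟨s', hs', hR'⟩ := hback _ _ _ _ hR₀ hs
    exact (ih _ hR').imp fun _ => .tau hs'
  | vis hs _ ih =>
    obtain ⟨s', hs', hR'⟩ := hback _ _ _ _ hR₀ hs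
    exact (ih _ hR').imp fun _ => .vis hs'

theorem LTS.Weak.of_append {Ev : Type} {L : LTS.{u} Ev} {s s' : L.State} {tr tr' : List Ev}
    (h : L.Weak s (tr ++ tr') s') : ∃ s₁, L.Weak s tr s₁ := by
  generalize hw : tr ++ tr' = w at h
  induction h generalizing tr with
  | refl =>
    obtain ⟨rfl, -⟩ := List.append_eq_nil_iff.1 hw
    exact ⟨_, .refl _⟩
  | tau hs _ ih => exact (ih hw).imp fun _ => .tau hs
  | vis hs _ ih =>
    rcases tr with _ | ⟨e, tr⟩
    · exact ⟨_, .refl _⟩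
    · obtain ⟨rfl, htr⟩ := List.cons.inj hw
      exact (ih htr).imp fun _ => .vis hs

theorem LTS.mem_traces_of_append {Ev : Type} {L : LTS.{u} Ev} {tr tr' : List Ev}
    (h : tr ++ tr' ∈ L.traces) : tr ∈ L.traces :=
  h.elim fun _ => Weak.of_append

theorem TypeSym.map_mem_traces {Impl : (n : ℕ) → LTS.{u} (Event S (Fin n))} (h : TypeSym Impl)
    {n : ℕ} (hn : 0 < n) (π : Fin n ≃ Fin n) {tr : List (Event S (Fin n))}
    (htr : tr ∈ (Impl n).traces) : tr.map (Event.map π) ∈ (Impl n).traces :=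
  (h n hn π).traces_subset (LTS.map_mem_traces_rename _ htr)

/-- At most `B` values can be permuted into `{0, …, B - 1}`. -/
theorem exists_perm_lt {n B : ℕ} (hn : B ≤ n) (W : Finset (Fin n)) (hW : W.card ≤ B) :
    ∃ π : Fin n ≃ Fin n, ∀ w ∈ W, (π w : ℕ) < B := by
  -- Padding to exactly `B` elements gives a bijection with the values below `B`, which extends to a
  -- permutation.
  obtain ⟨W', hWW', hW'⟩ := Finset.exists_superset_card_eq hW (by simpa using hn)
  have hcard : Fintype.card {x // x ∈ W'} = Fintype.card {x : Fin n // (x : ℕ) < B} := by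
    rw [Fintype.card_coe, hW', Fintype.card_subtype]
    rw [Fin.card_filter_val_lt, min_eq_right hn]
  refine ⟨(Fintype.equivOfCardEq hcard).extendSubtype, fun w hw => ?_⟩
  exact (Fintype.equivOfCardEq hcard).extendSubtype_mem w (hWW' hw)

/-- Only values from `B` upwards are merged, and they go to `B` itself, so fibres over smaller
values are singletons. -/
theorem IsCollapsing.eq_of_lt {B n : ℕ} {φ : Fin n → Fin (B + 1)} (hφ : IsCollapsing B φ)
    {v w : Fin n} (hv : (v : ℕ) < B) (h : φ w = φ v) : w = v := by
  have h₁ := (hφ v).1 hv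
  have h₂ := hφ w
  rw [h] at h₂
  ext
  by_contra hne
  rcases lt_or_ge (w : ℕ) B with hw | hw
  · exact hne ((h₂.1 hw).symm.trans h₁)
  · have := h₂.2 hw
    omega

end Symmetry

/-! ### Counting output positions and values -/

/-- The positions of the outputs of type `t` that `Spec` has after the channels and data `w` are
at most as many as the threshold. -/
theorem exists_outputsIn (E : Defns S) {A : Type} (P : Proc S A)
    (w : List ((c : S.Chan) × (S.DPos c → S.Val))) :
    ∃ D : Set ℕ, OutputsIn E P w D ∧ D.encard ≤ thresh E P := by
  by_cases h : ∃ (σ : List (SymLabel S)) (B : Type) (ε : SymEvent S B),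
      SymTrace E P (σ ++ [.vis ε]) ∧ (σ ++ [SymLabel.vis ε]).filterMap SymLabel.nonT = w
  · obtain ⟨σ, B, ε, hσ, rfl⟩ := h
    exact ⟨outPositions E P σ ε, fun σ' B' ε' hσ' hw m hm => ⟨σ', B', ε', hσ', hw.symm, hm⟩,
      le_sSup ⟨σ, B, ε, hσ, rfl⟩⟩
  · push Not at h
    -- Without a symbolic trace of this shape the condition is vacuous and no position is needed.
    exact ⟨∅, fun σ B ε hσ hw => absurd hw (h σ B ε hσ), by simp⟩

/-- The values that an event carries at at most `B` positions are at most `B` many. -/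
theorem exists_finset_tval {n B : ℕ} (e : Event S (Fin n)) {D : Set ℕ}
    (hD : D.encard ≤ (B : ℕ∞)) :
    ∃ W : Finset (Fin n), W.card ≤ B ∧ ∀ i : S.TPos e.chan, (i.1 : ℕ) ∈ D → e.tval i ∈ W := by
  classical
  let I : Finset (S.TPos e.chan) := Finset.univ.filter fun i => (i.1 : ℕ) ∈ D
  -- Repeated values only lower the count, so it suffices to count positions.
  refine ⟨I.image e.tval, Finset.card_image_le.trans ?_, fun i hi =>
    Finset.mem_image_of_mem _ (by simpa [I] using hi)⟩
  have hinj : Function.Injective fun i : S.TPos e.chan => (i.1 : ℕ) :=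
    Fin.val_injective.comp Subtype.val_injective
  have : ((I.image fun i => (i.1 : ℕ) : Finset ℕ) : Set ℕ) ⊆ D := by
    intro m hm
    simp only [Finset.coe_image, Set.mem_image, Finset.mem_coe, I, Finset.mem_filter,
      Finset.mem_univ, true_and] at hm
    obtain ⟨i, hi, rfl⟩ := hm
    exact hi
  have h := (Set.encard_le_encard this).trans hD
  rw [Set.encard_coe_eq_coe_finsetCard, Finset.card_image_of_injective _ hinj] at h
  exact_mod_cast h

end CSP

/-! ### The extendibility theorem -/

theorem theorem6p3 (S : CSP.Sig) (E : CSP.Defns S) (Spec : CSP.Proc S Empty)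
    (Impl : (n : ℕ) → CSP.LTS.{u} (CSP.Event S (Fin n)))
    (hNorm : CSP.SeqNorm E Spec) (hRev : CSP.RevPosConjEqT E Spec)
    (hSym : CSP.TypeSym Impl)
    (B n : ℕ) (hB : CSP.thresh E Spec ≤ (B : ℕ∞)) (hn : B + 1 ≤ n)
    (φ : Fin n → Fin (B + 1)) (hφ : CSP.IsCollapsing B φ)
    (hRef : CSP.LTS.TRefinedBy (Spec.inst E (B + 1))
      ((Impl n).rename (CSP.Event.map φ))) :
    CSP.LTS.TRefinedBy (Spec.inst E n) (Impl n) := by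
  intro tr
  induction tr using List.reverseRecOn with
  | nil => exact fun _ => ⟨_, .refl _⟩
  | append_singleton tr e ih =>
    intro h
    have hn' : 0 < n := by omega
    obtain ⟨N, htr⟩ := (CSP.mem_traces_map_iff ..).1 (ih (CSP.LTS.mem_traces_of_append h))
    obtain ⟨D, hD, hDB⟩ :=
      -- The identity is the initial choice of the renaming `ρ` in the lifting lemma.
      CSP.exists_outputsIn E (Spec.map id) ((tr ++ [e]).map CSP.Event.nonT)
    obtain ⟨W, hW, hWe⟩ := CSP.exists_finset_tval e (hDB.trans (by rwa [CSP.Proc.map_id]))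
    -- The permutation depends on `e` and is chosen afresh at each extension; nothing is asked of it
    -- on `tr`.
    obtain ⟨π, hπ⟩ := CSP.exists_perm_lt (by omega : B ≤ n) W hW
    have hf : ∀ i : S.TPos e.chan, (i.1 : ℕ) ∈ D → ∀ w, (φ ∘ π) w = (φ ∘ π) (e.tval i) →
        w = e.tval i := fun i hi w hw => π.injective (hφ.eq_of_lt (hπ _ (hWe i hi)) hw)
    have hφπ := (CSP.mem_traces_map_iff ..).1 (hRef (CSP.LTS.map_mem_traces_rename
      (CSP.Event.map φ) (hSym.map_mem_traces hn' π h)))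
    refine (CSP.mem_traces_map_iff ..).2 (CSP.accepts_concat_of_map hn' B.succ_pos hNorm hRev
      hf N .refl hD htr ?_)
    rw [List.map_map] at hφπ
    rwa [Subsingleton.elim ((φ ∘ π) ∘ Empty.elim) Empty.elim]
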